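/- Let $\mathcal A$ be a unital C$^*$-algebra, and let $\mathcal A^{**}$ denote its enveloping von Neumann algebra, i.e. the double commutant of $\mathcal A$ in its universal representation (the Hilbert sum of the GNS representations of all states), which is the standard realization of the second dual; $\mathcal A$ is regarded as a subalgebra of $\mathcal A^{**}$. On $\mathcal A^2$ let $\theta(\mathbf x,\mathbf y)=x_1^*y_1-x_2^*y_2$, and let $\mathcal U(\theta)$ be the group of all invertible $2\times 2$ matrices $g=\begin{pmatrix} g_{11}&g_{12}\\ g_{21}&g_{22}\end{pmatrix}$ over $\mathcal A$ such that $\theta(g\mathbf x,g\mathbf y)=\theta(\mathbf x,\mathbf y)$ for all $\mathbf x,\mathbf y\in\mathcal A^2$ (where $g$ acts by left multiplication on columns). Put $\partial\mathcal D=\{a\in\mathcal A^{**}:\|a\|=1\}$. Then for all $g\in\mathcal U(\theta)$ and $a\in\partial\mathcal D$ the element $g_{11}+g_{12}a$ is invertible in $\mathcal A^{**}$ and $$g\cdot a:=(g_{21}+g_{22}a)(g_{11}+g_{12}a)^{-1}\in\partial\mathcal D .$$ Moreover, this formula defines a left action of the group $\mathcal U(\theta)$ on $\partial\mathcal D$: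 $1\cdot a=a$ and $(gh)\cdot a=g\cdot(h\cdot a)$ for all $g,h\in\mathcal U(\theta)$, $a\in\partial\mathcal D$. -/

import Mathlib

open scoped ComplexOrder InnerProductSpace

noncomputable section

namespace PoincareDisk

universe u

/-! ### Hilbert sums of representations -/

section HilbertSum

variable {A : Type*} [CStarAlgebra A] {ι : Type*} {G : ι → Type*}
  [∀ i, NormedAddCommGroup (G i)] [∀ i, InnerProductSpace ℂ (G i)] [∀ i, CompleteSpace (G i)]

theorem norm_rep_apply_le {K : Type*} [NormedAddCommGroup K] [InnerProductSpace ℂ K]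
    [CompleteSpace K] (π : A →⋆ₐ[ℂ] (K →L[ℂ] K)) (a : A) (v : K) :
    ‖π a v‖ ≤ ‖a‖ * ‖v‖ :=
  ((π a).le_opNorm v).trans
    (mul_le_mul_of_nonneg_right (NonUnitalStarAlgHom.norm_apply_le π a) (norm_nonneg v))

theorem norm_rep_apply_le' (π : ∀ i, A →⋆ₐ[ℂ] (G i →L[ℂ] G i)) (a : A) (x : lp G 2) (i : ι) :
    ‖π i a (x i)‖ ≤ ‖(((‖a‖ : ℝ) : ℂ) • x : lp G 2) i‖ := by
  rw [lp.coeFn_smul, Pi.smul_apply, norm_smul, Complex.norm_real, norm_norm]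
  exact norm_rep_apply_le (π i) a (x i)

/-- The operator `(xᵢ)ᵢ ↦ (πᵢ(a) xᵢ)ᵢ` on the Hilbert sum of the spaces `G i`. -/
def hilbertSumOp (π : ∀ i, A →⋆ₐ[ℂ] (G i →L[ℂ] G i)) (a : A) : lp G 2 →L[ℂ] lp G 2 :=
  LinearMap.mkContinuous
    { toFun := fun x => ⟨fun i => π i a (x i),
        (lp.memℓp (((‖a‖ : ℝ) : ℂ) • x : lp G 2)).mono' (norm_rep_apply_le' π a x)⟩
      map_add' := fun x y => by
        ext i
        exact map_add (π i a) (x i) (y i)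
      map_smul' := fun c x => by
        ext i
        exact map_smul (π i a) c (x i) }
    ‖a‖ fun x => by
      refine (lp.norm_mono two_ne_zero (norm_rep_apply_le' π a x)).trans ?_
      rw [norm_smul, Complex.norm_real, norm_norm]

@[simp]
theorem hilbertSumOp_apply (π : ∀ i, A →⋆ₐ[ℂ] (G i →L[ℂ] G i)) (a : A) (x : lp G 2) (i : ι) :
    hilbertSumOp π a x i = π i a (x i) := rfl

/-- The Hilbert sum `⊕ᵢ πᵢ` of a family of representations of a C⋆-algebra. -/
def hilbertSum (π : ∀ i, A →⋆ₐ[ℂ] (G i →L[ℂ] G i)) : A →⋆ₐ[ℂ] (lp G 2 →L[ℂ] lp G 2) where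
  toFun := hilbertSumOp π
  map_one' := by
    ext x i
    simp
  map_mul' a b := by
    ext x i
    simp
  map_zero' := by
    ext x i
    simp
  map_add' a b := by
    ext x i
    simp
  commutes' r := by
    ext x i
    simp [Algebra.algebraMap_eq_smul_one]
  map_star' a := by
    refine (ContinuousLinearMap.eq_adjoint_iff _ _).mpr fun x y => ?_
    rw [lp.inner_eq_tsum, lp.inner_eq_tsum]
    refine tsum_congr fun i => ?_
    rw [hilbertSumOp_apply, hilbertSumOp_apply, map_star, ContinuousLinearMap.star_eq_adjoint,
      ContinuousLinearMap.adjoint_inner_left]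

end HilbertSum

/-! ### The enveloping von Neumann algebra `A**` -/

section Enveloping

variable (A : Type u) [CStarAlgebra A] [PartialOrder A] [StarOrderedRing A]

/-- The states of a unital C⋆-algebra: positive linear functionals with `φ(1) = 1`. -/
def State : Type u := {φ : A →ₚ[ℂ] ℂ // φ 1 = 1}

/-- The Hilbert space of the universal representation: the Hilbert sum, over all states, of the
corresponding GNS spaces. -/
abbrev UniversalSpace : Type u := lp (fun φ : State A => φ.1.GNS) 2

/-- The universal representation: the Hilbert sum of the GNS representations of all states. -/
def universalRep : A →⋆ₐ[ℂ] (UniversalSpace A →L[ℂ] UniversalSpace A) :=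
  hilbertSum fun φ : State A => φ.1.gnsStarAlgHom

/-- The enveloping von Neumann algebra of `A`: the double commutant of the image of `A` in its
universal representation. -/
def envelopingVonNeumannAlgebra : VonNeumannAlgebra (UniversalSpace A) where
  toStarSubalgebra := StarSubalgebra.centralizer ℂ
    (StarSubalgebra.centralizer ℂ
      (Set.range (universalRep A)) : Set (UniversalSpace A →L[ℂ] UniversalSpace A))
  centralizer_centralizer' := by
    have h := StarSubalgebra.coe_centralizer_centralizer ℂ (Set.range (universalRep A))
    refine (congrArg (fun s => Set.centralizer (Set.centralizer s)) h).trans (Eq.trans ?_ h.symm)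
    exact Set.centralizer_centralizer_centralizer _

/-- `A**` as a unital ⋆-algebra, with the operator norm. -/
abbrev Bidual : Type u := (envelopingVonNeumannAlgebra A).toStarSubalgebra

/-- The canonical unital ⋆-homomorphism `A → A**`. -/
def toBidual : A →⋆ₐ[ℂ] Bidual A :=
  (universalRep A).codRestrict _ fun a => by
    have h := StarSubalgebra.coe_centralizer_centralizer ℂ (Set.range (universalRep A))
    exact h.ge (Set.subset_centralizer_centralizer (Or.inl ⟨a, rfl⟩))

/-- The strong border `∂D = {a ∈ A** : ‖a‖ = 1}` of the unit disk of `A`. -/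
def border : Set (Bidual A) := {a | ‖a‖ = 1}

end Enveloping

/-! ### The unitary group of the form `θ` -/

section Theta

variable {A : Type u} [CStarAlgebra A]

/-- The form `θ(x, y) = x₁* y₁ - x₂* y₂` on `A²` (the two coordinates have indices `0` and `1`). -/
def theta (x y : Fin 2 → A) : A := star (x 0) * y 0 - star (x 1) * y 1

open Matrix in
/-- The group `U(θ)` of the invertible `2 × 2` matrices over `A` that, acting on `A²` by left
multiplication, preserve `θ`. -/
def unitaryTheta (A : Type u) [CStarAlgebra A] : Subgroup (Matrix (Fin 2) (Fin 2) A)ˣ where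
  carrier := {g | ∀ x y : Fin 2 → A, theta (g.1 *ᵥ x) (g.1 *ᵥ y) = theta x y}
  one_mem' x y := by simp
  mul_mem' {g h} hg hh x y := by
    rw [Units.val_mul, ← Matrix.mulVec_mulVec, ← Matrix.mulVec_mulVec]
    exact (hg _ _).trans (hh x y)
  inv_mem' {g} hg x y := by
    have := hg ((g⁻¹).1 *ᵥ x) ((g⁻¹).1 *ᵥ y)
    rw [Matrix.mulVec_mulVec, Matrix.mulVec_mulVec, Units.mul_inv, Matrix.one_mulVec,
      Matrix.one_mulVec] at this
    exact this.symm

variable [PartialOrder A] [StarOrderedRing A]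

/-- `g₂₁ + g₂₂ a` in `A**`. -/
def mobiusNum (g : unitaryTheta A) (a : Bidual A) : Bidual A :=
  toBidual A (g.1.1 1 0) + toBidual A (g.1.1 1 1) * a

/-- `g₁₁ + g₁₂ a` in `A**`. -/
def mobiusDen (g : unitaryTheta A) (a : Bidual A) : Bidual A :=
  toBidual A (g.1.1 0 0) + toBidual A (g.1.1 0 1) * a

end Theta

end PoincareDisk

end

open PoincareDisk

/-!
Identify `a` with the column `(1, a)` and a column `v` having `v₁` invertible with its affine
coordinate `c = v₂ v₁⁻¹`; the fractional action of `g` is then left multiplication by `g`. Since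
`θ(v, v) = v₁* (1 - c* c) v₁`, the conditions `‖c‖ ≤ 1` and `‖c‖ < 1` say that `θ(v, v)` is
positive, respectively strictly positive, and both are preserved by `U(θ)`. The group `U(θ)` is
closed under adjoints, so the first column of `g*` is a `θ`-unit vector too; this makes `g₁₁`
invertible with `‖g₁₁⁻¹ g₁₂‖ < 1`, hence `g₁₁ + g₁₂ a` is invertible for `‖a‖ ≤ 1`. Finally,
`A**` enters only through the ⋆-homomorphism `A → A**`, which induces `U(θ_A) → U(θ_{A**})`.
-/

namespace PoincareDisk

open Matrix MulOpposite

theorem isUnit_of_isUnit_mul_of_isUnit_mul {M : Type*} [Monoid M] {x y z : M}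
    (hyx : IsUnit (y * x)) (hxz : IsUnit (x * z)) : IsUnit x := by
  obtain ⟨u, hu⟩ := hyx
  obtain ⟨w, hw⟩ := hxz
  refine isUnit_iff_exists_and_exists.mpr ⟨⟨z * ↑w⁻¹, ?_⟩, ⟨↑u⁻¹ * y, ?_⟩⟩
  · rw [← mul_assoc, ← hw, w.mul_inv]
  · rw [mul_assoc, ← hu, u.inv_mul]

section AffineCoord

variable {R : Type*} [Semiring R]

/-- The affine coordinate `v₂ v₁⁻¹` of the point of the projective line over `R` spanned by the
column `v`. It is meaningful only when `v₁` is invertible, and `0` otherwise. -/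
noncomputable def affineCoord (v : Fin 2 → R) : R := v 1 * Ring.inverse (v 0)

/-- The linear fractional transformation `a ↦ (g₂₁ + g₂₂ a) (g₁₁ + g₁₂ a)⁻¹`, meaningful only
when the denominator is invertible. -/
noncomputable def mobius (g : Matrix (Fin 2) (Fin 2) R) (a : R) : R :=
  (g 1 0 + g 1 1 * a) * Ring.inverse (g 0 0 + g 0 1 * a)

theorem mulVec_one_cons (g : Matrix (Fin 2) (Fin 2) R) (a : R) (i : Fin 2) :
    (g *ᵥ ![1, a]) i = g i 0 + g i 1 * a := by
  simp [mulVec, dotProduct, Fin.sum_univ_two]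

theorem mobius_eq_affineCoord (g : Matrix (Fin 2) (Fin 2) R) (a : R) :
    mobius g a = affineCoord (g *ᵥ ![1, a]) := by
  rw [mobius, affineCoord, mulVec_one_cons, mulVec_one_cons]

theorem affineCoord_one_cons (a : R) : affineCoord ![1, a] = a := by
  simp [affineCoord]

theorem affineCoord_mul_apply_zero {v : Fin 2 → R} (hv : IsUnit (v 0)) :
    affineCoord v * v 0 = v 1 :=
  Ring.inverse_mul_cancel_right _ _ hv

theorem affineCoord_op_smul {d : R} (hd : IsUnit d) (v : Fin 2 → R) :
    affineCoord (op d • v) = affineCoord v := by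
  simp only [affineCoord, Pi.smul_apply, op_smul_eq_mul]
  rw [Ring.inverse_mul (.inr hd), mul_assoc, Ring.mul_inverse_cancel_left _ _ hd]

theorem op_smul_one_cons_affineCoord {v : Fin 2 → R} (hv : IsUnit (v 0)) :
    op (v 0) • ![1, affineCoord v] = v := by
  ext i
  fin_cases i
  · exact one_mul _
  · exact affineCoord_mul_apply_zero hv

theorem mobius_one (a : R) : mobius 1 a = a := by
  rw [mobius_eq_affineCoord, one_mulVec, affineCoord_one_cons]

theorem mobius_mul (g h : Matrix (Fin 2) (Fin 2) R) {a : R} (ha : IsUnit (h 0 0 + h 0 1 * a)) :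
    mobius (g * h) a = mobius g (mobius h a) := by
  rw [← mulVec_one_cons] at ha
  calc mobius (g * h) a
      = affineCoord (g *ᵥ (h *ᵥ ![1, a])) := by rw [mobius_eq_affineCoord, mulVec_mulVec]
    _ = affineCoord (op ((h *ᵥ ![1, a]) 0) • (g *ᵥ ![1, mobius h a])) := by
        rw [mobius_eq_affineCoord h, ← mulVec_smul, op_smul_one_cons_affineCoord ha]
    _ = mobius g (mobius h a) := by rw [affineCoord_op_smul ha, mobius_eq_affineCoord g]

end AffineCoord

section Theta

variable {B : Type*} [CStarAlgebra B]

theorem theta_self_eq_conjugate {v : Fin 2 → B} (hv : IsUnit (v 0)) :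
    theta v v = star (v 0) * (1 - star (affineCoord v) * affineCoord v) * v 0 := by
  rw [theta, ← affineCoord_mul_apply_zero hv, star_mul]
  noncomm_ring

section Order

variable [PartialOrder B] [StarOrderedRing B]

theorem norm_le_one_iff_nonneg_one_sub_star_mul_self (a : B) :
    ‖a‖ ≤ 1 ↔ 0 ≤ 1 - star a * a := by
  rw [sub_nonneg, ← CStarAlgebra.norm_le_one_iff_of_nonneg _ (star_mul_self_nonneg a),
    CStarRing.norm_star_mul_self, ← sq, sq_le_one_iff₀ (norm_nonneg a)]

theorem not_isUnit_one_sub_star_mul_self {a : B} (ha : ‖a‖ = 1) :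
    ¬ IsUnit (1 - star a * a) := by
  have : Nontrivial B := ⟨a, 0, fun h => by simp [h] at ha⟩
  have norm_mem := CStarAlgebra.norm_mem_spectrum_of_nonneg (star_mul_self_nonneg a)
  rwa [CStarRing.norm_star_mul_self, ha, mul_one, spectrum.mem_iff, map_one] at norm_mem

theorem norm_lt_one_iff_isStrictlyPositive_one_sub_star_mul_self (a : B) :
    ‖a‖ < 1 ↔ IsStrictlyPositive (1 - star a * a) := by
  rw [IsStrictlyPositive.iff_of_unital, ← norm_le_one_iff_nonneg_one_sub_star_mul_self]
  refine ⟨fun h => ⟨h.le, isUnit_one_sub_of_norm_lt_one ?_⟩,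
    fun h => h.1.lt_of_ne fun h₁ => not_isUnit_one_sub_star_mul_self h₁ h.2⟩
  rw [CStarRing.norm_star_mul_self]
  exact mul_lt_one_of_nonneg_of_lt_one_left (norm_nonneg a) h h.le

theorem norm_affineCoord_le_one_iff {v : Fin 2 → B} (hv : IsUnit (v 0)) :
    ‖affineCoord v‖ ≤ 1 ↔ 0 ≤ theta v v := by
  rw [theta_self_eq_conjugate hv, hv.star_left_conjugate_nonneg_iff,
    norm_le_one_iff_nonneg_one_sub_star_mul_self]

theorem norm_affineCoord_lt_one_iff {v : Fin 2 → B} (hv : IsUnit (v 0)) :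
    ‖affineCoord v‖ < 1 ↔ IsStrictlyPositive (theta v v) := by
  rw [theta_self_eq_conjugate hv, hv.isStrictlyPositive_star_left_conjugate_iff,
    norm_lt_one_iff_isStrictlyPositive_one_sub_star_mul_self]

theorem norm_affineCoord_eq_one_iff {v : Fin 2 → B} (hv : IsUnit (v 0)) :
    ‖affineCoord v‖ = 1 ↔ 0 ≤ theta v v ∧ ¬ IsUnit (theta v v) := by
  rw [eq_iff_le_not_lt, norm_affineCoord_le_one_iff hv, norm_affineCoord_lt_one_iff hv,
    IsStrictlyPositive.iff_of_unital]
  tauto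

end Order

theorem isUnit_star_mul_self_of_theta_self_eq_one {v : Fin 2 → B} (hv : theta v v = 1) :
    IsUnit (star (v 0) * v 0) := by
  let _ := CStarAlgebra.spectralOrder B
  let _ := CStarAlgebra.spectralOrderedRing B
  rw [sub_eq_iff_eq_add.mp hv]
  exact (isStrictlyPositive_one.add_nonneg (star_mul_self_nonneg (v 1))).isUnit

end Theta

section UnitaryTheta

variable {A B : Type*} [CStarAlgebra A] [CStarAlgebra B]

/-- The Gram matrix `diag(1, -1)` of the form `θ`. -/
def thetaMatrix (R : Type*) [Ring R] : Matrix (Fin 2) (Fin 2) R := diagonal ![1, -1]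

theorem thetaMatrix_mul_self (R : Type*) [Ring R] : thetaMatrix R * thetaMatrix R = 1 := by
  rw [thetaMatrix, diagonal_mul_diagonal, ← diagonal_one]
  congr 1
  ext i
  fin_cases i <;> simp

theorem mapMatrix_thetaMatrix {R S : Type*} [Ring R] [Ring S] (φ : R →+* S) :
    φ.mapMatrix (thetaMatrix R) = thetaMatrix S := by
  rw [thetaMatrix, thetaMatrix, RingHom.mapMatrix_apply, diagonal_map (map_zero φ)]
  congr 1
  ext i
  fin_cases i <;> simp

theorem theta_eq_dotProduct (x y : Fin 2 → A) : theta x y = star x ⬝ᵥ thetaMatrix A *ᵥ y := by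
  simp [theta, thetaMatrix, dotProduct, mulVec_diagonal, sub_eq_add_neg]

theorem theta_mulVec (g : Matrix (Fin 2) (Fin 2) A) (x y : Fin 2 → A) :
    theta (g *ᵥ x) (g *ᵥ y) = star x ⬝ᵥ (star g * thetaMatrix A * g) *ᵥ y := by
  rw [theta_eq_dotProduct, star_mulVec, ← dotProduct_mulVec, mulVec_mulVec, mulVec_mulVec,
    star_eq_conjTranspose, mul_assoc]

theorem mem_unitaryTheta_iff {g : (Matrix (Fin 2) (Fin 2) A)ˣ} :
    g ∈ unitaryTheta A ↔ star g.1 * thetaMatrix A * g.1 = thetaMatrix A := by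
  refine ⟨fun hg => Matrix.ext fun i j => ?_, fun hg x y => ?_⟩
  · have h := hg (Pi.single i 1) (Pi.single j 1)
    rw [theta_mulVec, theta_eq_dotProduct] at h
    simpa using h
  · rw [theta_mulVec, hg, theta_eq_dotProduct]

theorem star_mem_unitaryTheta {g : (Matrix (Fin 2) (Fin 2) A)ˣ} (hg : g ∈ unitaryTheta A) :
    star g ∈ unitaryTheta A := by
  have left_inv : thetaMatrix A * star g.1 * thetaMatrix A * g.1 = 1 := by
    rw [mul_assoc (thetaMatrix A), mul_assoc (thetaMatrix A), mem_unitaryTheta_iff.mp hg,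
      thetaMatrix_mul_self]
  have right_inv : g.1 * (thetaMatrix A * star g.1 * thetaMatrix A) = 1 := by
    rw [← Units.inv_eq_of_mul_eq_one_left left_inv, Units.mul_inv]
  rw [mem_unitaryTheta_iff, Units.coe_star, star_star]
  calc g.1 * thetaMatrix A * star g.1
      = g.1 * (thetaMatrix A * star g.1 * thetaMatrix A) * thetaMatrix A := by
        simp only [mul_assoc, thetaMatrix_mul_self, mul_one]
    _ = thetaMatrix A := by rw [right_inv, one_mul]

/-- The homomorphism `U(θ_A) → U(θ_B)` applying a unital ⋆-homomorphism `A → B` to the matrix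
entries. -/
def mapUnitaryTheta (φ : A →⋆ₐ[ℂ] B) : unitaryTheta A →* unitaryTheta B :=
  ((Units.map (φ : A →+* B).mapMatrix.toMonoidHom).comp (unitaryTheta A).subtype).codRestrict _
    fun g => by
      have star_map (M : Matrix (Fin 2) (Fin 2) A) :
          star ((φ : A →+* B).mapMatrix M) = (φ : A →+* B).mapMatrix (star M) :=
        (conjTranspose_map _ fun a => map_star φ a).symm
      have hg := congrArg (φ : A →+* B).mapMatrix (mem_unitaryTheta_iff.mp g.2)
      rw [map_mul, map_mul, mapMatrix_thetaMatrix, ← star_map] at hg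
      exact mem_unitaryTheta_iff.mpr hg

theorem theta_col_zero {g : (Matrix (Fin 2) (Fin 2) A)ˣ} (hg : g ∈ unitaryTheta A) :
    theta (g.1.col 0) (g.1.col 0) = 1 := by
  simpa [theta] using hg (Pi.single 0 1) (Pi.single 0 1)

theorem isUnit_apply_zero_zero (g : unitaryTheta B) : IsUnit (g.1.1 0 0) := by
  have left : IsUnit (star (g.1.1 0 0) * g.1.1 0 0) :=
    isUnit_star_mul_self_of_theta_self_eq_one (v := g.1.1.col 0) (theta_col_zero g.2)
  have right : IsUnit (star (star (g.1.1 0 0)) * star (g.1.1 0 0)) :=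
    isUnit_star_mul_self_of_theta_self_eq_one (v := (star g.1).1.col 0)
      (theta_col_zero (star_mem_unitaryTheta g.2))
  rw [star_star] at right
  exact isUnit_of_isUnit_mul_of_isUnit_mul left right

theorem norm_inverse_apply_zero_zero_mul_apply_zero_one_lt_one (g : unitaryTheta B) :
    ‖Ring.inverse (g.1.1 0 0) * g.1.1 0 1‖ < 1 := by
  let _ := CStarAlgebra.spectralOrder B
  let _ := CStarAlgebra.spectralOrderedRing B
  let v := (star g.1).1.col 0
  have hv : theta v v = 1 := theta_col_zero (star_mem_unitaryTheta g.2)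
  have coord : affineCoord v = star (Ring.inverse (g.1.1 0 0) * g.1.1 0 1) := by
    rw [star_mul, ← Ring.inverse_star]
    rfl
  rw [← norm_star, ← coord, norm_affineCoord_lt_one_iff (isUnit_apply_zero_zero g).star, hv]
  exact isStrictlyPositive_one

theorem isUnit_mobius_denom (g : unitaryTheta B) {a : B} (ha : ‖a‖ ≤ 1) :
    IsUnit (g.1.1 0 0 + g.1.1 0 1 * a) := by
  have hg := isUnit_apply_zero_zero g
  set c := Ring.inverse (g.1.1 0 0) * g.1.1 0 1 with hc
  have norm_lt : ‖-(c * a)‖ < 1 := by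
    rw [norm_neg]
    exact (norm_mul_le c a).trans_lt (mul_lt_one_of_nonneg_of_lt_one_left (norm_nonneg c)
      (norm_inverse_apply_zero_zero_mul_apply_zero_one_lt_one g) ha)
  have factor : g.1.1 0 0 + g.1.1 0 1 * a = g.1.1 0 0 * (1 - -(c * a)) := by
    rw [sub_neg_eq_add, mul_add, mul_one, hc, mul_assoc, Ring.mul_inverse_cancel_left _ _ hg]
  rw [factor]
  exact hg.mul (isUnit_one_sub_of_norm_lt_one norm_lt)

theorem norm_mobius_eq_one_iff (g : unitaryTheta B) {a : B} (ha : ‖a‖ ≤ 1) :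
    ‖mobius g.1.1 a‖ = 1 ↔ ‖a‖ = 1 := by
  let _ := CStarAlgebra.spectralOrder B
  let _ := CStarAlgebra.spectralOrderedRing B
  have hden : IsUnit ((g.1.1 *ᵥ ![1, a]) 0) := by
    rw [mulVec_one_cons]
    exact isUnit_mobius_denom g ha
  rw [mobius_eq_affineCoord, norm_affineCoord_eq_one_iff hden, g.2,
    ← norm_affineCoord_eq_one_iff (v := ![1, a]) isUnit_one, affineCoord_one_cons]

/-- The action of `U(θ)` on the unit sphere of a unital C⋆-algebra by linear fractional
transformations. -/
noncomputable instance sphereMulAction : MulAction (unitaryTheta B) {b : B | ‖b‖ = 1} where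
  smul g b := ⟨mobius g.1.1 b.1, (norm_mobius_eq_one_iff g b.2.le).mpr b.2⟩
  one_smul b := Subtype.ext (mobius_one b.1)
  mul_smul g h b := Subtype.ext (mobius_mul g.1.1 h.1.1 (isUnit_mobius_denom h b.2.le))

end UnitaryTheta

section VonNeumannAlgebra

variable {H : Type*} [NormedAddCommGroup H] [InnerProductSpace ℂ H] [CompleteSpace H]

theorem isClosed_toStarSubalgebra (S : VonNeumannAlgebra H) :
    IsClosed (S.toStarSubalgebra : Set (H →L[ℂ] H)) := by
  rw [VonNeumannAlgebra.coe_toStarSubalgebra, ← S.centralizer_centralizer]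
  exact Set.isClosed_centralizer _

noncomputable instance (S : VonNeumannAlgebra H) : CStarAlgebra S.toStarSubalgebra :=
  StarSubalgebra.cstarAlgebra _ (h_closed := isClosed_toStarSubalgebra S)

end VonNeumannAlgebra

end PoincareDisk

theorem proposition7_general {A B : Type*} [CStarAlgebra A] [CStarAlgebra B] (φ : A →⋆ₐ[ℂ] B) :
    (∀ (g : unitaryTheta A) (b : B), ‖b‖ ≤ 1 → IsUnit (φ (g.1.1 0 0) + φ (g.1.1 0 1) * b)) ∧
    (∀ (g : unitaryTheta A) (b : B), ‖b‖ ≤ 1 →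
      (‖mobius (g.1.1.map φ) b‖ = 1 ↔ ‖b‖ = 1)) ∧
    ∃ _ : MulAction (unitaryTheta A) {b : B | ‖b‖ = 1},
      ∀ (g : unitaryTheta A) (b : {b : B | ‖b‖ = 1}),
        ((g • b : {b : B | ‖b‖ = 1}) : B) = mobius (g.1.1.map φ) b :=
  ⟨fun g _ hb => isUnit_mobius_denom (mapUnitaryTheta φ g) hb,
    fun g _ hb => norm_mobius_eq_one_iff (mapUnitaryTheta φ g) hb,
    MulAction.compHom _ (mapUnitaryTheta φ), fun _ _ => rfl⟩

theorem proposition7 {A : Type*} [CStarAlgebra A] [PartialOrder A] [StarOrderedRing A] :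
    (∀ (g : unitaryTheta A) (a : Bidual A), a ∈ border A → IsUnit (mobiusDen g a)) ∧
    (∀ (g : unitaryTheta A) (a : Bidual A), a ∈ border A →
      mobiusNum g a * Ring.inverse (mobiusDen g a) ∈ border A) ∧
    ∃ _ : MulAction (unitaryTheta A) (border A), ∀ (g : unitaryTheta A) (a : border A),
      ((g • a : border A) : Bidual A) =
        mobiusNum g (a : Bidual A) * Ring.inverse (mobiusDen g (a : Bidual A)) :=
  have ⟨isUnit_den, norm_eq_one_iff, action⟩ := proposition7_general (toBidual A)
  ⟨fun g a ha => isUnit_den g a ha.le, fun g a ha => (norm_eq_one_iff g a ha.le).mpr ha, action⟩
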